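/- Let $\mathbb{R}_{\max}=(\mathbb{R}\cup\{-\infty\},\oplus,\odot)$ with $a\oplus b=\max(a,b)$, $a\odot b=a+b$, zero $\mathbb{0}=-\infty$, unit $\mathbb{1}=0$, and the usual order; products and powers below are taken in $\mathbb{R}_{\max}$. For an $n\times n$ matrix $A$ over $\mathbb{R}_{\max}$ let $\det(A)=\bigoplus_{\sigma\in S_n}\bigodot_{i=1}^n A_{i,\sigma(i)}$; $A$ is called nonsingular if $\det(A)\neq\mathbb{0}$, and then its quasi-inverse is $A^\nabla=\det(A)^{-1}\operatorname{adj}(A)$, where $\operatorname{adj}(A)_{i,j}$ is the determinant of $A$ with row $j$ and column $i$ deleted. Let $f_A=\det(X\mathcal I\oplus A)=\bigoplus_{k=0}^n a_kX^k$. The eigenvalues of $A$ are the corner roots of $f_A$: those $r\neq\mathbb{0}$ at which the maximum in $f_A(r)=\bigoplus_k a_kr^k$ is attained at least twice, and $r=\mathbb{0}$ if $f_A(\mathbb{0})=\mathbb{0}$. The multiplicity of a corner root $r$ is the difference between the right and left slopes at $r$ of the piecewise affine function $x\mapsto f_A(x)$ (for $r=\mathbb{0}=-\infty$: the slope of $f_A$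 near $-\infty$). Counted with multiplicities, every $n\times n$ matrix has exactly $n$ eigenvalues. Let $A,M$ be $n\times n$ matrices over $\mathbb{R}_{\max}$ and let $g$ be a map such that one of the following holds: (a) $M=E^\nabla AE$ for a nonsingular $n\times n$ matrix $E$ over $\mathbb{R}_{\max}$, and $g:\mathbb{R}_{\max}\to\mathbb{R}_{\max}$, $g(x)=x$; (b) $A$ is nonsingular, $M=A^\nabla$, and $g:\mathbb{R}_{\max}\setminus\{\mathbb{0}\}\to\mathbb{R}_{\max}\setminus\{\mathbb{0}\}$, $g(x)=x^{-1}$ (in this case all eigenvalues of $A$ are different from $\mathbb{0}$); (c) $M=A^m$ for an integer $m\ge 1$, and $g:\mathbb{R}_{\max}\to\mathbb{R}_{\max}$, $g(x)=x^m$. Let $\lambda_1,\dots,\lambda_n$ and $\gamma_1,\dots,\gamma_n$ be the eigenvalues of $M$ and of $A$, respectively, counted with multiplicities and ordered so that $\lambda_1\ge\cdots\ge\lambda_n$ and $g(\gamma_1)\ge\cdots\ge g(\gamma_n)$. Then $$\lambda_1\cdots\lambda_k\ \ge\ g(\gamma_1)\cdots g(\gamma_k)\qquad\text{for all }k\in\{1,\dots,n\},$$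 and in case (b) equality holds for $k=n$. -/

import Mathlib

open Polynomial

/-- The max-plus semiring `ℝ ∪ {-∞}`. Multiplicatively it is the group `(ℝ, +)`, written
multiplicatively, with an absorbing element `0 = -∞` adjoined; so `1` is the real number `0`.
The order is the usual order of `ℝ ∪ {-∞}`. The semiring addition, defined below, is `max`. -/
def Rmax : Type := WithZero (Multiplicative ℝ)

namespace Rmax

noncomputable instance : LinearOrderedCommGroupWithZero Rmax :=
  inferInstanceAs (LinearOrderedCommGroupWithZero (WithZero (Multiplicative ℝ)))

/-- Max-plus addition is the maximum. -/
noncomputable instance : Add Rmax := ⟨fun a b => max a b⟩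

noncomputable instance : CommSemiring Rmax :=
  { (inferInstance : LinearOrderedCommGroupWithZero Rmax) with
    add_assoc := fun a b c => max_assoc a b c
    add_comm := fun a b => max_comm a b
    zero_add := fun a => max_eq_right zero_le
    add_zero := fun a => max_eq_left zero_le
    nsmul := nsmulRec
    left_distrib := fun a b c =>
      (Monotone.map_max (f := fun x : Rmax => a * x) fun _ _ h => mul_le_mul_right h a)
    right_distrib := fun a b c =>
      (Monotone.map_max (f := fun x : Rmax => x * c) fun _ _ h => mul_le_mul_left h c) }

theorem add_eq_max (a b : Rmax) : a + b = max a b := rfl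

/-- Nonsingular: the determinant is invertible. Over `Rmax` all signs are `1`, so the
determinant is the permanent. -/
def Nonsingular {n : ℕ} (A : Matrix (Fin n) (Fin n) Rmax) : Prop :=
  IsUnit A.permanent

/-- The adjoint matrix: its `(i, j)` entry is the determinant (here: permanent) of the matrix
obtained from `A` by deleting row `j` and column `i`. -/
noncomputable def adjoint : {n : ℕ} → Matrix (Fin n) (Fin n) Rmax → Matrix (Fin n) (Fin n) Rmax
  | 0, A => A
  | _ + 1, A => Matrix.of fun i j => (A.submatrix j.succAbove i.succAbove).permanent

/-- The quasi-inverse `adj(A) det(A)⁻¹` (meaningful for nonsingular `A`). -/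
noncomputable def quasiInverse {n : ℕ} (A : Matrix (Fin n) (Fin n) Rmax) :
    Matrix (Fin n) (Fin n) Rmax :=
  (A.permanent)⁻¹ • adjoint A

/-- The formal characteristic polynomial `det(X I ⊖ A)`; over `Rmax` the symmetry `⊖` is the
identity. -/
noncomputable def charpoly {n : ℕ} (A : Matrix (Fin n) (Fin n) Rmax) : Rmax[X] :=
  ((X : Rmax[X]) • (1 : Matrix (Fin n) (Fin n) Rmax[X]) + A.map C).permanent

/-- Corner roots: `r = 0` (that is `-∞`) if `P(0) = 0`; and `r ≠ 0` if `P(r)` is the sum of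
at least two monomials with nonsingular coefficients, each attaining the maximum. -/
def IsCornerRoot (P : Rmax[X]) (r : Rmax) : Prop :=
  (r = 0 ∧ P.eval r = 0) ∨
  (r ≠ 0 ∧ ∃ S : Finset ℕ, 2 ≤ S.card ∧
    (∀ k ∈ S, IsUnit (P.coeff k) ∧ P.coeff k * r ^ k = P.eval r) ∧
    P.eval r = ∑ k ∈ S, P.coeff k * r ^ k)

/-- `s` is the right slope at `r` of the polynomial function of `P`: immediately to the right
of `r`, the function is `x ↦ c ⊙ x^s`, that is, in the usual notation of `ℝ`, the affine
function `x ↦ c + s x`. For `r = 0 = -∞` this is the slope near `-∞`. -/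
def IsRightSlope (P : Rmax[X]) (r : Rmax) (s : ℕ) : Prop :=
  ∃ c : Rmax, c ≠ 0 ∧ ∃ b : Rmax, r < b ∧ ∀ x : Rmax, r < x → x < b → P.eval x = c * x ^ s

/-- `s` is the left slope at `r` of the polynomial function of `P`; at `r = 0 = -∞`, where
there is nothing to the left, it is `0` by convention. -/
def IsLeftSlope (P : Rmax[X]) (r : Rmax) (s : ℕ) : Prop :=
  (r = 0 ∧ s = 0) ∨
  ∃ c : Rmax, c ≠ 0 ∧ ∃ b : Rmax, b < r ∧ ∀ x : Rmax, b < x → x < r → P.eval x = c * x ^ s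

/-- `μ` is the multiplicity of `r`: the right slope minus the left slope at `r`. -/
def HasMultiplicity (P : Rmax[X]) (r : Rmax) (μ : ℕ) : Prop :=
  ∃ s t : ℕ, IsRightSlope P r s ∧ IsLeftSlope P r t ∧ s = t + μ

/-- The eigenvalues of `A` are the corner roots of its characteristic polynomial. -/
def IsEigenvalue {n : ℕ} (A : Matrix (Fin n) (Fin n) Rmax) (r : Rmax) : Prop :=
  IsCornerRoot (charpoly A) r

/-- `γ` lists the eigenvalues of `A`, in some order, each repeated according to its
multiplicity. -/
structure ListsEigenvalues {n : ℕ} (A : Matrix (Fin n) (Fin n) Rmax) (γ : Fin n → Rmax) :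
    Prop where
  isEigenvalue : ∀ i, IsEigenvalue A (γ i)
  multiplicity : ∀ r, IsEigenvalue A r →
    HasMultiplicity (charpoly A) r (Finset.univ.filter fun i => γ i = r).card

/-- Conjugation: `M = E^∇ A E` with `E` nonsingular, `g` the identity. -/
def ConjugationCase {n : ℕ} (A M : Matrix (Fin n) (Fin n) Rmax) (g : Rmax → Rmax) : Prop :=
  ∃ E : Matrix (Fin n) (Fin n) Rmax,
    Nonsingular E ∧ M = quasiInverse E * A * E ∧ g = fun x => x

/-- Quasi-inverse: `M = A^∇` with `A` nonsingular, `g` the inversion. (Only the values of `g`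
at invertible elements are meaningful.) -/
def QuasiInverseCase {n : ℕ} (A M : Matrix (Fin n) (Fin n) Rmax) (g : Rmax → Rmax) : Prop :=
  Nonsingular A ∧ M = quasiInverse A ∧ g = fun x => x⁻¹

/-- Powers: `M = A ^ m`, `g` the `m`-th power map, with `m ≥ 1` (so that `g` is invertible). -/
def PowerCase {n : ℕ} (A M : Matrix (Fin n) (Fin n) Rmax) (g : Rmax → Rmax) : Prop :=
  ∃ m : ℕ, 1 ≤ m ∧ M = A ^ m ∧ g = fun x => x ^ m

end Rmax

/-!
Write `f_A` for the function `x ↦ (charpoly A).eval x = per(x I ⊕ A)`. By the max-plus fundamental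
theorem of algebra (`exists_sum_eq_prod_max`) it is a product `∏ i, max x (γ i)`. The corner roots
and multiplicities can be read off from such a product (`isCornerRoot_iff`,
`hasMultiplicity_of_eval_eq_prod_max`), and one-sided slopes are unique, so a list of the
eigenvalues of `A` is the same thing as a factorization of `f_A`
(`ListsEigenvalues.eval_charpoly`).

If `∏ i, max x (δ i) ≤ ∏ i, max x (l i)` for all `x ≠ 0`, with `l` decreasing, then evaluating at
`x = l k` (or near `-∞`, if `l k = 0`) bounds the product of the first `k` entries of `δ` by that of
`l` (`prod_Iic_le_of_prod_max_le`). Hence it suffices to bound `f_M` from below.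

* Conjugation: for an optimal permutation of `E`, with monomial matrix `D`, one has `E ≥ D` and
  `E^∇ ≥ D⁻¹`, so `E^∇ A E ≥ D⁻¹ A D`, and `f` is invariant under monomial conjugation.
* Powers: the entry of `A ^ m` at `(τ ^ m i, i)` dominates the weight of the `m`-step path of `τ`
  from `i`, whence `f_A(x) ^ m ≤ f_{A ^ m}(x ^ m)`.
* Quasi-inverse: the bound is `det(A)⁻¹ x ^ n f_A(x⁻¹) ≤ f_{A^∇}(x)`, a max-plus version of
  Jacobi's identity for the minors of an inverse. The inverse of an optimal permutation bounds
  `det(A)⁻¹` by a product of entries of `A^∇`. The entries of `A` in a monomial of `f_A` join these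
  into paths, and `A^∇ A A^∇ ≤ A^∇` contracts each path to one entry of `A^∇`
  (`exists_prod_mul_prod_quasiInverse_le`). That inequality is `adjoint_mul_mul_adjoint_le`, which
  rests on splitting a `2`-regular bipartite multigraph into two perfect matchings. Contracting all
  paths to closed ones also gives `det(A^∇) = det(A)⁻¹`, the equality for `k = n`.
-/

namespace Rmax

/-! ### Order and sums in the max-plus semiring -/

theorem le_sum {ι : Type*} {s : Finset ι} {i : ι} (f : ι → Rmax) (hi : i ∈ s) :
    f i ≤ ∑ j ∈ s, f j := by
  classical
  rw [← Finset.add_sum_erase s f hi, add_eq_max]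
  exact le_max_left _ _

theorem sum_le {ι : Type*} {s : Finset ι} {f : ι → Rmax} {a : Rmax} (h : ∀ i ∈ s, f i ≤ a) :
    ∑ i ∈ s, f i ≤ a := by
  classical
  induction s using Finset.induction_on with
  | empty => exact zero_le
  | insert i s hi ih =>
    rw [Finset.sum_insert hi, add_eq_max]
    exact max_le (h i (Finset.mem_insert_self i s))
      (ih fun j hj => h j (Finset.mem_insert_of_mem hj))

theorem exists_sum_eq {ι : Type*} {s : Finset ι} (hs : s.Nonempty) (f : ι → Rmax) :
    ∃ i ∈ s, ∑ j ∈ s, f j = f i := by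
  obtain ⟨i, hi, h⟩ := s.exists_max_image f hs
  exact ⟨i, hi, le_antisymm (sum_le h) (le_sum f hi)⟩

/-- Roots of every positive order exist in `Rmax`, because `(ℝ, +)` is divisible. -/
theorem exists_pow_eq (a : Rmax) {m : ℕ} (hm : m ≠ 0) : ∃ x : Rmax, x ^ m = a := by
  rcases (show WithZero (Multiplicative ℝ) from a) with _ | r
  · exact ⟨0, zero_pow hm⟩
  · refine ⟨((Multiplicative.ofAdd (r.toAdd / m) : Multiplicative ℝ) :
      WithZero (Multiplicative ℝ)), ?_⟩
    refine (WithZero.coe_pow _ _).symm.trans ?_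
    refine congrArg _ ?_
    rw [← ofAdd_nsmul, nsmul_eq_mul, mul_div_cancel₀ _ (by exact_mod_cast hm)]
    rfl

instance : NoMaxOrder Rmax where
  exists_gt a := by
    have ht : (1 : Rmax) <
        ((Multiplicative.ofAdd (1 : ℝ) : Multiplicative ℝ) : WithZero (Multiplicative ℝ)) :=
      WithZero.coe_lt_coe.2 (Multiplicative.ofAdd_lt.2 one_pos)
    rcases eq_or_ne a 0 with rfl | ha
    · exact ⟨1, zero_lt_one⟩
    · exact ⟨a * _, lt_mul_of_one_lt_right (zero_lt_iff.2 ha) ht⟩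

instance : DenselyOrdered Rmax where
  dense a b h := by
    have hb : (0 : Rmax) < b := zero_le.trans_lt h
    rcases eq_or_ne a 0 with rfl | ha
    · obtain ⟨t, ht⟩ := exists_gt (1 : Rmax)
      have ht0 : 0 < t := zero_lt_one.trans ht
      exact ⟨b / t, div_pos hb ht0, (div_lt_iff₀ ht0).2 (lt_mul_of_one_lt_right hb ht)⟩
    · -- the max-plus square root of `a * b` is the arithmetic mean of `a` and `b`
      obtain ⟨c, hc⟩ := exists_pow_eq (a * b) two_ne_zero
      have ha0 := zero_lt_iff.2 ha
      refine ⟨c, ?_, ?_⟩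
      · refine lt_of_pow_lt_pow_left₀ 2 zero_le ?_
        rw [hc, pow_two]; exact mul_lt_mul_of_pos_left h ha0
      · refine lt_of_pow_lt_pow_left₀ 2 zero_le ?_
        rw [hc, pow_two]; exact mul_lt_mul_of_pos_right h hb

/-! ### Permanents and the characteristic polynomial function -/

/-- Over `Rmax` the permanent is attained by one permutation. -/
theorem exists_permanent_eq {n : ℕ} (A : Matrix (Fin n) (Fin n) Rmax) :
    ∃ σ : Equiv.Perm (Fin n), A.permanent = ∏ i, A (σ i) i := by
  obtain ⟨σ, -, h⟩ := exists_sum_eq Finset.univ_nonempty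
    fun σ : Equiv.Perm (Fin n) => ∏ i, A (σ i) i
  exact ⟨σ, h⟩

theorem prod_le_permanent {n : ℕ} (A : Matrix (Fin n) (Fin n) Rmax) (σ : Equiv.Perm (Fin n)) :
    ∏ i, A (σ i) i ≤ A.permanent :=
  le_sum (fun σ : Equiv.Perm (Fin n) => ∏ i, A (σ i) i) (Finset.mem_univ σ)

theorem eval_charpoly {n : ℕ} (A : Matrix (Fin n) (Fin n) Rmax) (x : Rmax) :
    (charpoly A).eval x = (x • (1 : Matrix (Fin n) (Fin n) Rmax) + A).permanent := by
  simp only [charpoly, Matrix.permanent, eval_finsetSum, eval_prod]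
  refine Finset.sum_congr rfl fun σ _ => Finset.prod_congr rfl fun i _ => ?_
  by_cases h : σ i = i
  · simp [h]
  · simp [Matrix.one_apply_ne h]

/-- A permutation `τ` and a set `S` of fixed points of `τ`, at which the diagonal entry `x`
is chosen, contribute a monomial to the characteristic polynomial. -/
theorem prod_le_eval_charpoly {n : ℕ} (A : Matrix (Fin n) (Fin n) Rmax) (x : Rmax)
    (τ : Equiv.Perm (Fin n)) (S : Finset (Fin n)) (hS : ∀ i ∈ S, τ i = i) :
    (∏ _i ∈ S, x) * ∏ i ∈ Sᶜ, A (τ i) i ≤ (charpoly A).eval x := by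
  rw [eval_charpoly]
  refine le_trans ?_ (prod_le_permanent _ τ)
  rw [← Finset.prod_mul_prod_compl S fun i => (x • (1 : Matrix (Fin n) (Fin n) Rmax) + A) (τ i) i]
  refine mul_le_mul' (Finset.prod_le_prod' fun i hi => ?_) (Finset.prod_le_prod' fun i _ => ?_)
  · simp [hS i hi, add_eq_max]
  · simp [add_eq_max]

theorem exists_eval_charpoly_eq {n : ℕ} (A : Matrix (Fin n) (Fin n) Rmax) (x : Rmax) :
    ∃ (τ : Equiv.Perm (Fin n)) (S : Finset (Fin n)), (∀ i ∈ S, τ i = i) ∧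
      (charpoly A).eval x = (∏ _i ∈ S, x) * ∏ i ∈ Sᶜ, A (τ i) i := by
  classical
  obtain ⟨τ, h⟩ := exists_permanent_eq (x • (1 : Matrix (Fin n) (Fin n) Rmax) + A)
  have key : ∀ i, (x • (1 : Matrix (Fin n) (Fin n) Rmax) + A) (τ i) i ≠ A (τ i) i →
      τ i = i ∧ (x • (1 : Matrix (Fin n) (Fin n) Rmax) + A) (τ i) i = x := by
    intro i hi
    by_cases hτ : τ i = i
    · refine ⟨hτ, ?_⟩
      rw [hτ] at hi ⊢
      simp only [Matrix.add_apply, Matrix.smul_apply, Matrix.one_apply_eq, smul_eq_mul, mul_one,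
        add_eq_max] at hi ⊢
      exact (max_choice _ _).resolve_right hi
    · exact absurd (by simp [Matrix.one_apply_ne hτ]) hi
  refine ⟨τ, Finset.univ.filter fun i =>
    (x • (1 : Matrix (Fin n) (Fin n) Rmax) + A) (τ i) i ≠ A (τ i) i,
    fun i hi => (key i (Finset.mem_filter.1 hi).2).1, ?_⟩
  rw [eval_charpoly, h, ← Finset.prod_mul_prod_compl (Finset.univ.filter fun i =>
    (x • (1 : Matrix (Fin n) (Fin n) Rmax) + A) (τ i) i ≠ A (τ i) i)]
  congr 1
  · exact Finset.prod_congr rfl fun i hi => (key i (Finset.mem_filter.1 hi).2).2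
  · refine Finset.prod_congr rfl fun i hi => ?_
    by_contra hne
    exact Finset.mem_compl.1 hi (Finset.mem_filter.2 ⟨Finset.mem_univ i, hne⟩)

theorem eval_charpoly_zero {n : ℕ} (A : Matrix (Fin n) (Fin n) Rmax) :
    (charpoly A).eval 0 = A.permanent := by
  rw [eval_charpoly, zero_smul, zero_add]

/-! ### Factorization of max-plus polynomial functions -/

/-- The max-plus fundamental theorem of algebra: a polynomial function of degree `n` is a product
of `n` linear factors `x ⊕ γ i`. The proof splits off the largest root
`max_{k < n} (a k / a n) ^ (1 / (n - k))`. -/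
theorem exists_sum_eq_prod_max (n : ℕ) (a : ℕ → Rmax) (ha : a n ≠ 0) :
    ∃ γ : Fin n → Rmax, ∀ x, ∑ k ∈ Finset.range (n + 1), a k * x ^ k
      = a n * ∏ i, max x (γ i) := by
  induction n generalizing a with
  | zero => exact ⟨Fin.elim0, fun x => by simp⟩
  | succ n ih =>
    have hroot : ∀ k : ℕ, ∃ ρ : Rmax, k ≤ n → ρ ^ (n + 1 - k) = a k / a (n + 1) := by
      intro k
      by_cases hk : k ≤ n
      · obtain ⟨ρ, h⟩ := exists_pow_eq (a k / a (n + 1)) (m := n + 1 - k) (by omega)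
        exact ⟨ρ, fun _ => h⟩
      · exact ⟨0, fun h => absurd h hk⟩
    choose ρ hρ using hroot
    obtain ⟨k₀, hk₀, hmax⟩ := (Finset.range (n + 1)).exists_max_image ρ ⟨0, by simp⟩
    set c := ρ k₀ with hc
    have hk₀n : k₀ ≤ n := Nat.lt_succ_iff.1 (Finset.mem_range.1 hk₀)
    have hle : ∀ k ≤ n, a k ≤ a (n + 1) * c ^ (n + 1 - k) := by
      intro k hk
      have h1 : ρ k ^ (n + 1 - k) ≤ c ^ (n + 1 - k) :=
        pow_le_pow_left' (hmax k (Finset.mem_range.2 (by omega))) _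
      rw [hρ k hk, div_le_iff₀ (zero_lt_iff.2 ha)] at h1
      rwa [mul_comm]
    have heq : a k₀ = a (n + 1) * c ^ (n + 1 - k₀) := by
      rw [hc, hρ k₀ hk₀n, mul_div_cancel₀ _ ha]
    -- if `c = 0` all lower coefficients vanish; otherwise split off the factor `x ⊕ c`, the other
    -- factor being `a (n + 1) x ^ n ⊕ c⁻¹ ∑ k < n, a k x ^ k`
    rcases eq_or_ne c 0 with hc0 | hc0
    · refine ⟨fun _ => 0, fun x => ?_⟩
      rw [Finset.sum_range_succ, Finset.sum_eq_zero, zero_add]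
      · simp
      · intro k hk
        have hk' : k ≤ n := Nat.lt_succ_iff.1 (Finset.mem_range.1 hk)
        have h := hle k hk'
        rw [hc0, zero_pow (by omega), mul_zero] at h
        rw [le_antisymm h zero_le, zero_mul]
    · have hcpos : 0 < c := zero_lt_iff.2 hc0
      obtain ⟨γ, hγ⟩ := ih (fun k => if k < n then a k * c⁻¹ else a (n + 1)) (by simpa using ha)
      refine ⟨Fin.cons c γ, fun x => ?_⟩
      have hg : ∑ k ∈ Finset.range n, (if k < n then a k * c⁻¹ else a (n + 1)) * x ^ k
          = c⁻¹ * ∑ k ∈ Finset.range n, a k * x ^ k := by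
        rw [Finset.mul_sum]
        refine Finset.sum_congr rfl fun k hk => ?_
        rw [if_pos (Finset.mem_range.1 hk)]
        ring
      have hγx := hγ x
      rw [Finset.sum_range_succ, hg] at hγx
      simp only [lt_irrefl, if_false] at hγx
      rw [Fin.prod_univ_succ, Fin.cons_zero, mul_left_comm]
      simp only [Fin.cons_succ]
      rw [← hγx, Finset.sum_range_succ, Finset.sum_range_succ]
      set g := ∑ k ∈ Finset.range n, a k * x ^ k with hgdef
      have hterm : ∀ k ≤ n, a k * x ^ k ≤ g + a n * x ^ n := by
        intro k hk
        rw [hgdef, ← Finset.sum_range_succ fun k => a k * x ^ k]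
        exact le_sum (fun k => a k * x ^ k) (Finset.mem_range.2 (Nat.lt_succ_iff.2 hk))
      have h1 : g + a n * x ^ n + a (n + 1) * x ^ (n + 1)
          = max (g + a n * x ^ n) (a (n + 1) * x ^ (n + 1)) := rfl
      have h2 : c⁻¹ * g + a (n + 1) * x ^ n = max (c⁻¹ * g) (a (n + 1) * x ^ n) := rfl
      refine le_antisymm ?_ ?_
      · rw [h1]
        have hg' : g ≤ max x c * (c⁻¹ * g + a (n + 1) * x ^ n) :=
          calc g = c * (c⁻¹ * g) := (mul_inv_cancel_left₀ hc0 g).symm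
            _ ≤ _ := mul_le_mul' (le_max_right _ _) (h2 ▸ le_max_left _ _)
        have hn := hle n le_rfl
        rw [Nat.add_sub_cancel_left, pow_one] at hn
        refine max_le (max_le hg' ?_) ?_
        · calc a n * x ^ n ≤ a (n + 1) * c * x ^ n := mul_le_mul' hn le_rfl
            _ = c * (a (n + 1) * x ^ n) := by ring
            _ ≤ _ := mul_le_mul' (le_max_right _ _) (h2 ▸ le_max_right _ _)
        · calc a (n + 1) * x ^ (n + 1) = x * (a (n + 1) * x ^ n) := by ring
            _ ≤ _ := mul_le_mul' (le_max_left _ _) (h2 ▸ le_max_right _ _)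
      · rcases le_total x c with hx | hx
        · rw [max_eq_right hx, mul_add, mul_inv_cancel_left₀ hc0, h1]
          refine max_le ((le_max_left _ _).trans (le_max_left _ _)) (le_max_of_le_left ?_)
          refine le_trans ?_ (hterm k₀ hk₀n)
          rw [heq]
          obtain ⟨j, rfl⟩ := Nat.exists_eq_add_of_le hk₀n
          rw [show k₀ + j + 1 - k₀ = j + 1 by omega]
          calc c * (a (k₀ + j + 1) * x ^ (k₀ + j)) = a (k₀ + j + 1) * c * x ^ k₀ * x ^ j := by ring
            _ ≤ a (k₀ + j + 1) * c * x ^ k₀ * c ^ j := mul_le_mul' le_rfl (pow_le_pow_left' hx j)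
            _ = _ := by ring
        · rw [max_eq_left hx, mul_add, h1]
          refine max_le (le_max_of_le_right ?_) (le_max_of_le_right (le_of_eq (by ring)))
          rw [hgdef, Finset.mul_sum, Finset.mul_sum]
          refine sum_le fun k hk => ?_
          have hk' : k < n := Finset.mem_range.1 hk
          obtain ⟨j, rfl⟩ := Nat.exists_eq_add_of_le hk'.le
          have := hle k hk'.le
          rw [show k + j + 1 - k = j + 1 by omega] at this
          calc x * (c⁻¹ * (a k * x ^ k))
              ≤ x * (c⁻¹ * (a (k + j + 1) * c ^ (j + 1) * x ^ k)) := by gcongr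
            _ = a (k + j + 1) * x ^ (k + 1) * c ^ j * (c⁻¹ * c) := by ring
            _ = a (k + j + 1) * x ^ (k + 1) * c ^ j := by rw [inv_mul_cancel₀ hc0, mul_one]
            _ ≤ a (k + j + 1) * x ^ (k + 1) * x ^ j := mul_le_mul' le_rfl (pow_le_pow_left' hx j)
            _ = _ := by ring

theorem exists_eval_charpoly_eq_prod_max {n : ℕ} (A : Matrix (Fin n) (Fin n) Rmax) :
    ∃ γ : Fin n → Rmax, ∀ x, (charpoly A).eval x = ∏ i, max x (γ i) := by
  have hentry : ∀ i j,
      (((X : Rmax[X]) • (1 : Matrix (Fin n) (Fin n) Rmax[X]) + A.map C) i j).natDegree ≤ 1 := by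
    intro i j
    refine (natDegree_add_le _ _).trans (max_le ?_ ?_)
    · by_cases h : i = j
      · subst h; simp
      · simp [h]
    · simp
  have hdeg : (charpoly A).natDegree ≤ n := by
    refine natDegree_sum_le_of_forall_le _ _ fun σ _ => (natDegree_prod_le _ _).trans ?_
    refine (Finset.sum_le_sum fun i _ => hentry (σ i) i).trans (by simp)
  have hcoeff : (charpoly A).coeff n = 1 := by
    rw [charpoly, Matrix.permanent, finsetSum_coeff, ← Matrix.permanent_one (n := Fin n),
      Matrix.permanent]
    refine Finset.sum_congr rfl fun σ _ => ?_
    have := coeff_prod_of_natDegree_le (s := Finset.univ)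
      (fun i => ((X : Rmax[X]) • (1 : Matrix (Fin n) (Fin n) Rmax[X]) + A.map C) (σ i) i) 1
      fun i _ => hentry (σ i) i
    rw [Finset.card_univ, Fintype.card_fin, mul_one] at this
    rw [this]
    refine Finset.prod_congr rfl fun i _ => ?_
    by_cases h : σ i = i
    · rw [h]; simp
    · simp [Matrix.one_apply_ne h]
  obtain ⟨γ, hγ⟩ := exists_sum_eq_prod_max n (charpoly A).coeff (by rw [hcoeff]; exact one_ne_zero)
  refine ⟨γ, fun x => ?_⟩
  rw [eval_eq_sum_range' (Nat.lt_succ_iff.2 hdeg), hγ, hcoeff, one_mul]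

/-! ### Slopes and corner roots -/

theorem coeff_mul_pow_le_eval (P : Rmax[X]) (k : ℕ) (x : Rmax) : P.coeff k * x ^ k ≤ P.eval x := by
  by_cases hk : k ∈ P.support
  · rw [eval_eq_sum]
    exact le_sum (fun k => P.coeff k * x ^ k) hk
  · rw [notMem_support_iff.1 hk, zero_mul]
    exact zero_le

theorem exists_eval_eq_coeff_mul_pow (P : Rmax[X]) (x : Rmax) :
    ∃ k, P.eval x = P.coeff k * x ^ k := by
  rw [eval_eq_sum_range]
  obtain ⟨k, -, h⟩ := exists_sum_eq ⟨0, Finset.mem_range.2 (Nat.succ_pos _)⟩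
    fun k => P.coeff k * x ^ k
  exact ⟨k, h⟩

/-- A monomial that dominates at `u` and is dominated at `v > u` has the smaller exponent. -/
theorem le_of_mul_pow_le {u v c d : Rmax} {k s : ℕ} (hu : 0 < u) (huv : u < v) (hc : c ≠ 0)
    (h₁ : c * u ^ s ≤ d * u ^ k) (h₂ : d * v ^ k ≤ c * v ^ s) : k ≤ s := by
  by_contra! hks
  obtain ⟨j, rfl⟩ := Nat.exists_eq_add_of_lt hks
  have hv : 0 < v := hu.trans huv
  have hc' : 0 < c := zero_lt_iff.2 hc
  have hd : d ≠ 0 := by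
    rintro rfl
    rw [zero_mul] at h₁
    exact (mul_pos hc' (pow_pos hu s)).not_ge h₁
  have h := mul_le_mul' h₁ h₂
  have e₁ : c * u ^ s * (d * v ^ (s + j + 1)) = c * d * u ^ s * v ^ s * v ^ (j + 1) := by ring
  have e₂ : d * u ^ (s + j + 1) * (c * v ^ s) = c * d * u ^ s * v ^ s * u ^ (j + 1) := by ring
  rw [e₁, e₂, mul_le_mul_iff_right₀ (mul_pos
    (mul_pos (mul_pos hc' (zero_lt_iff.2 hd)) (pow_pos hu s)) (pow_pos hv s))] at h
  exact (pow_lt_pow_left₀ huv zero_le (Nat.succ_ne_zero j)).not_ge h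

/-- A monomial which gives the value of `P` on an open interval is a term of `P`. -/
theorem coeff_eq_of_eval_eq {P : Rmax[X]} {a b c : Rmax} {s : ℕ} (hab : a < b) (hc : c ≠ 0)
    (h : ∀ x, a < x → x < b → P.eval x = c * x ^ s) : P.coeff s = c := by
  obtain ⟨y, hay, hyb⟩ := exists_between hab
  obtain ⟨u, hau, huy⟩ := exists_between hay
  obtain ⟨v, hyv, hvb⟩ := exists_between hyb
  have hu : 0 < u := zero_le.trans_lt hau
  have hy : 0 < y := zero_le.trans_lt hay
  obtain ⟨k, hk⟩ := exists_eval_eq_coeff_mul_pow P y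
  have hky := hk.symm.trans (h y hay hyb)
  have hk0 : P.coeff k ≠ 0 := by
    intro h0
    rw [h0, zero_mul] at hky
    exact (mul_pos (zero_lt_iff.2 hc) (pow_pos hy s)).ne hky
  have h₁ : k ≤ s := le_of_mul_pow_le hy hyv hc hky.ge
    ((coeff_mul_pow_le_eval P k v).trans (h v (hay.trans hyv) hvb).le)
  have h₂ : s ≤ k := le_of_mul_pow_le hu huy hk0
    ((coeff_mul_pow_le_eval P k u).trans (h u hau (huy.trans hyb)).le) hky.ge
  obtain rfl := le_antisymm h₁ h₂
  exact mul_right_cancel₀ (pow_pos hy k).ne' hky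

theorem exponent_eq_of_eval_eq {P : Rmax[X]} {a b c d : Rmax} {s t : ℕ} (hab : a < b) (hc : c ≠ 0)
    (hd : d ≠ 0) (hs : ∀ x, a < x → x < b → P.eval x = c * x ^ s)
    (ht : ∀ x, a < x → x < b → P.eval x = d * x ^ t) : s = t := by
  obtain ⟨u, hau, hub⟩ := exists_between hab
  obtain ⟨v, huv, hvb⟩ := exists_between hub
  have hu : 0 < u := zero_le.trans_lt hau
  have e₁ := (hs u hau hub).symm.trans (ht u hau hub)
  have e₂ := (hs v (hau.trans huv) hvb).symm.trans (ht v (hau.trans huv) hvb)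
  exact le_antisymm (le_of_mul_pow_le hu huv hd e₁.ge e₂.le)
    (le_of_mul_pow_le hu huv hc e₁.le e₂.ge)

theorem IsRightSlope.eq {P : Rmax[X]} {r : Rmax} {s t : ℕ} (hs : IsRightSlope P r s)
    (ht : IsRightSlope P r t) : s = t := by
  obtain ⟨c, hc, b, hb, h⟩ := hs
  obtain ⟨d, hd, b', hb', h'⟩ := ht
  exact exponent_eq_of_eval_eq (lt_min hb hb') hc hd
    (fun x h₁ h₂ => h x h₁ (h₂.trans_le (min_le_left _ _)))
    (fun x h₁ h₂ => h' x h₁ (h₂.trans_le (min_le_right _ _)))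

theorem IsLeftSlope.eq {P : Rmax[X]} {r : Rmax} {s t : ℕ} (hs : IsLeftSlope P r s)
    (ht : IsLeftSlope P r t) : s = t := by
  rcases hs with ⟨hr, rfl⟩ | ⟨c, hc, b, hb, h⟩ <;> rcases ht with ⟨hr', rfl⟩ | ⟨d, hd, b', hb', h'⟩
  · rfl
  · exact absurd (hr ▸ hb') not_lt_zero
  · exact absurd (hr' ▸ hb) not_lt_zero
  · exact exponent_eq_of_eval_eq (max_lt hb hb') hc hd
      (fun x h₁ h₂ => h x ((le_max_left _ _).trans_lt h₁) h₂)
      (fun x h₁ h₂ => h' x ((le_max_right _ _).trans_lt h₁) h₂)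

theorem HasMultiplicity.eq {P : Rmax[X]} {r : Rmax} {μ ν : ℕ} (hμ : HasMultiplicity P r μ)
    (hν : HasMultiplicity P r ν) : μ = ν := by
  obtain ⟨s, t, hs, ht, h⟩ := hμ
  obtain ⟨s', t', hs', ht', h'⟩ := hν
  have := hs.eq hs'
  have := ht.eq ht'
  omega

section ProdMax

variable {n : ℕ} (γ : Fin n → Rmax) (r : Rmax)

/-- The product of linear factors immediately to the right of `r`. -/
theorem prod_max_eq_of_le {x : Rmax} (h₁ : ∀ i, r < γ i → x ≤ γ i) (h₂ : ∀ i, γ i ≤ r → γ i ≤ x) :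
    ∏ i, max x (γ i)
      = (∏ i with r < γ i, γ i) * x ^ (Finset.univ.filter fun i => γ i ≤ r).card := by
  rw [← Finset.prod_filter_mul_prod_filter_not Finset.univ (fun i => r < γ i)]
  congr 1
  · exact Finset.prod_congr rfl fun i hi => max_eq_right (h₁ i (Finset.mem_filter.1 hi).2)
  · rw [Finset.prod_congr rfl fun i hi => max_eq_left
      (h₂ i (not_lt.1 (Finset.mem_filter.1 hi).2)), Finset.prod_const]
    simp only [not_lt]

/-- The product of linear factors immediately to the left of `r`. -/
theorem prod_max_eq_of_lt {x : Rmax} (h₁ : ∀ i, r ≤ γ i → x ≤ γ i) (h₂ : ∀ i, γ i < r → γ i ≤ x) :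
    ∏ i, max x (γ i)
      = (∏ i with r ≤ γ i, γ i) * x ^ (Finset.univ.filter fun i => γ i < r).card := by
  rw [← Finset.prod_filter_mul_prod_filter_not Finset.univ (fun i => r ≤ γ i)]
  congr 1
  · exact Finset.prod_congr rfl fun i hi => max_eq_right (h₁ i (Finset.mem_filter.1 hi).2)
  · rw [Finset.prod_congr rfl fun i hi => max_eq_left
      (h₂ i (not_le.1 (Finset.mem_filter.1 hi).2)), Finset.prod_const]
    simp only [not_le]

theorem exists_gt_forall_le : ∃ b, r < b ∧ ∀ i, r < γ i → b ≤ γ i := by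
  by_cases h : ∃ i, r < γ i
  · obtain ⟨j, hj, hmin⟩ := (Finset.univ.filter fun i => r < γ i).exists_min_image γ
      (by obtain ⟨i, hi⟩ := h; exact ⟨i, by simpa using hi⟩)
    exact ⟨γ j, (Finset.mem_filter.1 hj).2,
      fun i hi => hmin i (Finset.mem_filter.2 ⟨Finset.mem_univ i, hi⟩)⟩
  · obtain ⟨b, hb⟩ := exists_gt r
    exact ⟨b, hb, fun i hi => absurd ⟨i, hi⟩ h⟩

theorem exists_lt_forall_le (hr : r ≠ 0) : ∃ b, b < r ∧ ∀ i, γ i < r → γ i ≤ b := by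
  by_cases h : ∃ i, γ i < r
  · obtain ⟨j, hj, hmax⟩ := (Finset.univ.filter fun i => γ i < r).exists_max_image γ
      (by obtain ⟨i, hi⟩ := h; exact ⟨i, by simpa using hi⟩)
    exact ⟨γ j, (Finset.mem_filter.1 hj).2,
      fun i hi => hmax i (Finset.mem_filter.2 ⟨Finset.mem_univ i, hi⟩)⟩
  · exact ⟨0, zero_lt_iff.2 hr, fun i hi => absurd ⟨i, hi⟩ h⟩

variable {γ r} {P : Rmax[X]}

theorem card_le_eq_card_lt_add :
    (Finset.univ.filter fun i => γ i ≤ r).card = (Finset.univ.filter fun i => γ i < r).card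
      + (Finset.univ.filter fun i => γ i = r).card := by
  rw [← Finset.card_union_of_disjoint]
  · congr 1
    ext i
    simp [le_iff_lt_or_eq]
  · refine Finset.disjoint_filter.2 fun i _ h h' => h.ne h'

theorem hasMultiplicity_of_eval_eq_prod_max (h : ∀ x, P.eval x = ∏ i, max x (γ i)) (r : Rmax) :
    HasMultiplicity P r (Finset.univ.filter fun i => γ i = r).card := by
  refine ⟨_, _, ?_, ?_, card_le_eq_card_lt_add⟩
  · obtain ⟨b, hb, hmin⟩ := exists_gt_forall_le γ r
    refine ⟨∏ i with r < γ i, γ i, Finset.prod_ne_zero_iff.2 fun i hi =>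
      (zero_le.trans_lt (Finset.mem_filter.1 hi).2).ne', b, hb, fun x h₁ h₂ => ?_⟩
    rw [h, prod_max_eq_of_le γ r (fun i hi => h₂.le.trans (hmin i hi)) fun i hi => hi.trans h₁.le]
  · rcases eq_or_ne r 0 with rfl | hr
    · exact Or.inl ⟨rfl, by simp⟩
    · obtain ⟨b, hb, hmax⟩ := exists_lt_forall_le γ r hr
      refine Or.inr ⟨∏ i with r ≤ γ i, γ i, Finset.prod_ne_zero_iff.2 fun i hi =>
        ((zero_lt_iff.2 hr).trans_le (Finset.mem_filter.1 hi).2).ne', b, hb, fun x h₁ h₂ => ?_⟩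
      rw [h, prod_max_eq_of_lt γ r (fun i hi => h₂.le.trans hi) fun i hi => (hmax i hi).trans h₁.le]

theorem isCornerRoot_iff (h : ∀ x, P.eval x = ∏ i, max x (γ i)) :
    IsCornerRoot P r ↔ ∃ i, γ i = r := by
  rcases eq_or_ne r 0 with rfl | hr
  · simp [IsCornerRoot, h, Finset.prod_eq_zero_iff]
  have hr0 : 0 < r := zero_lt_iff.2 hr
  obtain ⟨b, hb, hmin⟩ := exists_gt_forall_le γ r
  obtain ⟨a, ha, hmax⟩ := exists_lt_forall_le γ r hr
  set c := ∏ i with r < γ i, γ i with hc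
  set d := ∏ i with r ≤ γ i, γ i with hd
  set s := (Finset.univ.filter fun i => γ i ≤ r).card with hs
  set t := (Finset.univ.filter fun i => γ i < r).card with ht
  have hc0 : c ≠ 0 := Finset.prod_ne_zero_iff.2 fun i hi =>
    (zero_le.trans_lt (Finset.mem_filter.1 hi).2).ne'
  have hd0 : d ≠ 0 := Finset.prod_ne_zero_iff.2 fun i hi =>
    (hr0.trans_le (Finset.mem_filter.1 hi).2).ne'
  have hright : ∀ x, r ≤ x → x < b → P.eval x = c * x ^ s := fun x h₁ h₂ => by
    rw [h, prod_max_eq_of_le γ r (fun i hi => h₂.le.trans (hmin i hi)) fun i hi => hi.trans h₁]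
  have hleft : ∀ x, a < x → x ≤ r → P.eval x = d * x ^ t := fun x h₁ h₂ => by
    rw [h, prod_max_eq_of_lt γ r (fun i hi => h₂.trans hi) fun i hi => (hmax i hi).trans h₁.le]
  have hst : s = t + (Finset.univ.filter fun i => γ i = r).card := card_le_eq_card_lt_add
  constructor
  · rintro (⟨h0, -⟩ | ⟨-, S, hS, hSr, -⟩)
    · exact absurd h0 hr
    · obtain ⟨k, hk, l, hl, hkl⟩ := Finset.one_lt_card.1 hS
      -- an exponent attained at `r` lies between the left slope `t` and the right slope `s`, which
      -- agree unless `r` is among the `γ i`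
      have key : ∀ k ∈ S, t ≤ k ∧ k ≤ s := by
        intro k hk
        obtain ⟨hu, he⟩ := hSr k hk
        obtain ⟨v, hrv, hvb⟩ := exists_between hb
        obtain ⟨u, hau, hur⟩ := exists_between ha
        constructor
        · exact le_of_mul_pow_le (zero_le.trans_lt hau) hur hu.ne_zero
            ((coeff_mul_pow_le_eval P k u).trans (hleft u hau hur.le).le)
            ((hleft r ha le_rfl).symm.trans he.symm).le
        · exact le_of_mul_pow_le hr0 hrv hc0 ((hright r le_rfl hb).symm.trans he.symm).le
            ((coeff_mul_pow_le_eval P k v).trans (hright v hrv.le hvb).le)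
      by_contra hne
      have h0 : (Finset.univ.filter fun i => γ i = r).card = 0 := by
        rw [Finset.card_eq_zero, Finset.filter_eq_empty_iff]
        exact fun i _ hi => hne ⟨i, hi⟩
      have := key k hk
      have := key l hl
      omega
  · -- the exponents `s` and `t` of the slopes are both attained at `r`
    rintro ⟨i, hi⟩
    have hpos : 0 < (Finset.univ.filter fun i => γ i = r).card :=
      Finset.card_pos.2 ⟨i, by simpa using hi⟩
    have hcs : P.coeff s = c := coeff_eq_of_eval_eq hb hc0 fun x h₁ h₂ => hright x h₁.le h₂
    have hdt : P.coeff t = d := coeff_eq_of_eval_eq ha hd0 fun x h₁ h₂ => hleft x h₁ h₂.le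
    have es : P.coeff s * r ^ s = P.eval r := by rw [hcs, hright r le_rfl hb]
    have et : P.coeff t * r ^ t = P.eval r := by rw [hdt, hleft r ha le_rfl]
    refine Or.inr ⟨hr, {s, t}, ?_, ?_, ?_⟩
    · rw [Finset.card_pair (by omega)]
    · intro k hk
      rcases Finset.mem_insert.1 hk with rfl | hk
      · exact ⟨hcs ▸ hc0.isUnit, es⟩
      · obtain rfl := Finset.mem_singleton.1 hk
        exact ⟨hdt ▸ hd0.isUnit, et⟩
    · rw [Finset.sum_pair (by omega), es, et, add_eq_max, max_self]

end ProdMax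

theorem listsEigenvalues_of_eval_eq_prod_max {n : ℕ} {A : Matrix (Fin n) (Fin n) Rmax}
    {γ : Fin n → Rmax} (h : ∀ x, (charpoly A).eval x = ∏ i, max x (γ i)) :
    ListsEigenvalues A γ :=
  ⟨fun i => (isCornerRoot_iff h).2 ⟨i, rfl⟩, fun r _ => hasMultiplicity_of_eval_eq_prod_max h r⟩

/-- A list of the eigenvalues is unique up to order, so it factors the characteristic
polynomial function. -/
theorem ListsEigenvalues.eval_charpoly {n : ℕ} {A : Matrix (Fin n) (Fin n) Rmax}
    {γ : Fin n → Rmax} (hγ : ListsEigenvalues A γ) (x : Rmax) :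
    (charpoly A).eval x = ∏ i, max x (γ i) := by
  obtain ⟨δ, hδ⟩ := exists_eval_charpoly_eq_prod_max A
  have hcount : ∀ r, (Finset.univ.filter fun i => δ i = r).card
      = (Finset.univ.filter fun i => γ i = r).card := by
    intro r
    by_cases hr : IsEigenvalue A r
    · exact (hasMultiplicity_of_eval_eq_prod_max hδ r).eq (hγ.multiplicity r hr)
    · rw [Finset.card_eq_zero.2, Finset.card_eq_zero.2]
      · exact Finset.filter_eq_empty_iff.2 fun i _ hi => hr (hi ▸ hγ.isEigenvalue i)
      · exact Finset.filter_eq_empty_iff.2 fun i _ hi => hr ((isCornerRoot_iff hδ).2 ⟨i, hi⟩)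
  have hms : Finset.univ.val.map δ = Finset.univ.val.map γ := by
    ext r
    rw [Multiset.count_map, Multiset.count_map]
    simpa only [eq_comm, Finset.card_def, Finset.filter_val] using hcount r
  rw [hδ]
  have := congrArg (fun s : Multiset Rmax => (s.map fun y => max x y).prod) hms
  rw [Multiset.map_map, Multiset.map_map] at this
  exact this

/-! ### Weak majorization -/

/-- Weak majorization from a comparison of products of linear factors: for decreasing `l`,
comparing `∏ (x ⊕ δ i)` and `∏ (x ⊕ l i)` at `x = l k` compares the products of the entries up to
`k`. -/
theorem prod_Iic_le_of_prod_max_le {n : ℕ} {l δ : Fin n → Rmax} (hl : Antitone l)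
    (h : ∀ x, x ≠ 0 → ∏ i, max x (δ i) ≤ ∏ i, max x (l i)) (k : Fin n) :
    ∏ i ∈ Finset.Iic k, δ i ≤ ∏ i ∈ Finset.Iic k, l i := by
  have hlow : ∀ x, (∏ i ∈ Finset.Iic k, δ i) * x ^ (Finset.Iic k)ᶜ.card ≤ ∏ i, max x (δ i) := by
    intro x
    rw [← Finset.prod_mul_prod_compl (Finset.Iic k) fun i => max x (δ i), ← Finset.prod_const]
    exact mul_le_mul' (Finset.prod_le_prod' fun i _ => le_max_right _ _)
      (Finset.prod_le_prod' fun i _ => le_max_left _ _)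
  rcases eq_or_ne (l k) 0 with h0 | h0
  · -- near `-∞` the right-hand side has slope larger than `n - k`
    have hzero : ∀ i, k ≤ i → l i = 0 := fun i hi => le_antisymm (h0 ▸ hl hi) zero_le
    set G := ∏ i ∈ Finset.Iic k, δ i with hG
    rcases eq_or_ne G 0 with hG0 | hG0
    · rw [hG0]; exact zero_le
    exfalso
    set K := ∏ i ∈ Finset.Iio k, max 1 (l i) with hK
    have hK0 : 0 < K := zero_lt_one.trans_le (Finset.one_le_prod' fun i _ => le_max_left _ _)
    have hup : ∀ x ≤ 1, ∏ i, max x (l i) ≤ K * (x * x ^ (Finset.Iic k)ᶜ.card) := by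
      intro x hx
      have hcompl : (Finset.Iio k)ᶜ = insert k (Finset.Iic k)ᶜ := by
        ext i
        rw [Finset.mem_compl, Finset.mem_Iio, Finset.mem_insert, Finset.mem_compl, Finset.mem_Iic,
          not_lt, not_le, le_iff_eq_or_lt, eq_comm]
      rw [← Finset.prod_mul_prod_compl (Finset.Iio k)]
      refine mul_le_mul' (Finset.prod_le_prod' fun i _ => max_le_max_right _ hx) ?_
      rw [hcompl, Finset.prod_insert (by simp), ← Finset.prod_const]
      refine mul_le_mul' (max_le le_rfl (h0.le.trans zero_le)) (Finset.prod_le_prod' fun i hi => ?_)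
      rw [Finset.mem_compl, Finset.mem_Iic, not_le] at hi
      exact max_le le_rfl ((hzero i hi.le).le.trans zero_le)
    obtain ⟨x, hx0, hx⟩ := exists_between
      (lt_min zero_lt_one (div_pos (zero_lt_iff.2 hG0) hK0) : 0 < min 1 (G / K))
    have hx1 : x < 1 := hx.trans_le (min_le_left _ _)
    have hxG : x < G / K := hx.trans_le (min_le_right _ _)
    have := (hlow x).trans ((h x hx0.ne').trans (hup x hx1.le))
    rw [← mul_assoc, mul_le_mul_iff_left₀ (pow_pos hx0 _)] at this
    rw [lt_div_iff₀ hK0, mul_comm] at hxG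
    exact hxG.not_ge this
  · have hpos := zero_lt_iff.2 h0
    have heq : ∏ i, max (l k) (l i)
        = (∏ i ∈ Finset.Iic k, l i) * (l k) ^ (Finset.Iic k)ᶜ.card := by
      rw [← Finset.prod_mul_prod_compl (Finset.Iic k), ← Finset.prod_const]
      congr 1
      · exact Finset.prod_congr rfl fun i hi => max_eq_right (hl (Finset.mem_Iic.1 hi))
      · refine Finset.prod_congr rfl fun i hi => max_eq_left (hl ?_)
        rw [Finset.mem_compl, Finset.mem_Iic, not_le] at hi
        exact hi.le
    have := (hlow (l k)).trans ((h _ h0).trans heq.le)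
    rwa [mul_le_mul_iff_left₀ (pow_pos hpos _)] at this

/-! ### Entries of the adjoint matrix -/

/-- Together with `exists_adjoint_eq`: the `(i, j)` entry of the adjoint is the maximal weight,
without its factor in column `i`, of a permutation mapping `i` to `j`. -/
theorem prod_erase_le_adjoint {n : ℕ} (A : Matrix (Fin n) (Fin n) Rmax)
    (σ : Equiv.Perm (Fin n)) (i : Fin n) :
    ∏ k ∈ Finset.univ.erase i, A (σ k) k ≤ adjoint A i (σ i) := by
  cases n with
  | zero => exact i.elim0
  | succ n =>
    have hne : ∀ k, σ (i.succAbove k) ≠ σ i := fun k h => Fin.succAbove_ne i k (σ.injective h)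
    choose f hf using fun k => Fin.exists_succAbove_eq (hne k)
    have hinj : Function.Injective f := fun k l h =>
      Fin.succAbove_right_injective (σ.injective (by rw [← hf k, ← hf l, h]))
    refine le_trans (le_of_eq ?_) (prod_le_permanent _
      (Equiv.ofBijective f (Finite.injective_iff_bijective.1 hinj)))
    have hne' : Finset.univ.erase i = Finset.univ.image i.succAbove := by
      ext k
      simp
    rw [hne', Finset.prod_image fun k _ l _ h => Fin.succAbove_right_injective h]
    refine Finset.prod_congr rfl fun k _ => ?_
    rw [Matrix.submatrix_apply, Equiv.ofBijective_apply, hf]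

theorem exists_adjoint_eq {n : ℕ} (A : Matrix (Fin n) (Fin n) Rmax) (i j : Fin n) :
    ∃ σ : Equiv.Perm (Fin n), σ i = j ∧
      adjoint A i j = ∏ k ∈ Finset.univ.erase i, A (σ k) k := by
  cases n with
  | zero => exact i.elim0
  | succ n =>
    obtain ⟨τ, hτ⟩ := exists_permanent_eq (A.submatrix j.succAbove i.succAbove)
    have hi : ((finSuccEquiv' i).trans ((Equiv.optionCongr τ).trans (finSuccEquiv' j).symm)) i
        = j := by simp
    refine ⟨_, hi, ?_⟩
    have hne' : Finset.univ.erase i = Finset.univ.image i.succAbove := by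
      ext k
      simp
    rw [hne', Finset.prod_image fun k _ l _ h => Fin.succAbove_right_injective h]
    refine Eq.trans hτ (Finset.prod_congr rfl fun k _ => ?_)
    simp

/-! ### Regular bipartite multigraphs -/

/-- A `d`-regular bipartite multigraph, `d > 0`, has a perfect matching. This is extracted from
Birkhoff's theorem. -/
theorem exists_perm_pos_of_sum_eq {ι : Type*} [Fintype ι] [DecidableEq ι] (N : ι → ι → ℕ) {d : ℕ}
    (hd : 0 < d) (hrow : ∀ i, ∑ j, N i j = d) (hcol : ∀ j, ∑ i, N i j = d) :
    ∃ σ : Equiv.Perm ι, ∀ i, 0 < N i (σ i) := by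
  have hd' : (d : ℚ) ≠ 0 := by exact_mod_cast hd.ne'
  have hM : (Matrix.of fun i j => (N i j : ℚ) / d) ∈ doublyStochastic ℚ ι := by
    rw [mem_doublyStochastic_iff_sum]
    refine ⟨fun i j => by simp only [Matrix.of_apply]; positivity, fun i => ?_, fun j => ?_⟩
    · simp only [Matrix.of_apply]
      rw [← Finset.sum_div, ← Nat.cast_sum, hrow, div_self hd']
    · simp only [Matrix.of_apply]
      rw [← Finset.sum_div, ← Nat.cast_sum, hcol, div_self hd']
  obtain ⟨w, hw, hw1, hwM⟩ := exists_eq_sum_perm_of_mem_doublyStochastic hM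
  obtain ⟨σ, -, hσ⟩ := Finset.exists_ne_zero_of_sum_ne_zero (hw1 ▸ one_ne_zero : ∑ σ, w σ ≠ 0)
  refine ⟨σ, fun i => Nat.pos_of_ne_zero fun h0 => ?_⟩
  have h := congrFun (congrFun hwM i) (σ i)
  rw [Matrix.sum_apply, Matrix.of_apply, h0, Nat.cast_zero, zero_div,
    Finset.sum_eq_zero_iff_of_nonneg] at h
  · have := h σ (Finset.mem_univ σ)
    simp [Equiv.Perm.permMatrix, Equiv.toPEquiv_apply, PEquiv.toMatrix_apply] at this
    exact hσ this
  · intro τ _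
    refine mul_nonneg (hw τ) ?_
    simp only [Equiv.Perm.permMatrix, PEquiv.toMatrix_apply]
    split_ifs <;> norm_num

/-- A `2`-regular bipartite multigraph is the union of two perfect matchings. -/
theorem exists_perm_add_eq {ι : Type*} [Fintype ι] [DecidableEq ι] (N : ι → ι → ℕ)
    (hrow : ∀ i, ∑ j, N i j = 2) (hcol : ∀ j, ∑ i, N i j = 2) :
    ∃ σ τ : Equiv.Perm ι, ∀ i j,
      N i j = (if σ i = j then 1 else 0) + (if τ i = j then 1 else 0) := by
  obtain ⟨σ, hσ⟩ := exists_perm_pos_of_sum_eq N two_pos hrow hcol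
  have hle : ∀ i j, (if σ i = j then 1 else 0) ≤ N i j := by
    intro i j
    split_ifs with h
    · exact h ▸ hσ i
    · exact Nat.zero_le _
  choose N' hN' using fun i j => Nat.exists_eq_add_of_le (hle i j)
  have hσcol : ∀ j, ∑ i, (if σ i = j then 1 else 0) = 1 := by
    intro j
    rw [Finset.sum_congr rfl fun i _ => if_congr σ.eq_symm_apply.symm rfl rfl]
    simp
  have hrow' : ∀ i, ∑ j, N' i j = 1 := by
    intro i
    have := hrow i
    rw [Finset.sum_congr rfl fun j _ => hN' i j, Finset.sum_add_distrib] at this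
    simp at this
    omega
  have hcol' : ∀ j, ∑ i, N' i j = 1 := by
    intro j
    have := hcol j
    rw [Finset.sum_congr rfl fun i _ => hN' i j, Finset.sum_add_distrib, hσcol] at this
    omega
  obtain ⟨τ, hτ⟩ := exists_perm_pos_of_sum_eq N' one_pos hrow' hcol'
  refine ⟨σ, τ, fun i j => ?_⟩
  rw [hN' i j]
  congr 1
  have h1 := hrow' i
  rw [← Finset.add_sum_erase _ _ (Finset.mem_univ (τ i))] at h1
  have := hτ i
  split_ifs with h
  · subst h; omega
  · have h2 : ∑ j ∈ Finset.univ.erase (τ i), N' i j = 0 := by omega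
    exact Finset.sum_eq_zero_iff.1 h2 j (Finset.mem_erase.2 ⟨Ne.symm h, Finset.mem_univ j⟩)

variable {n : ℕ}

/-! ### The quasi-inverse -/

/-- The max-plus form of `A^∇ A A^∇ ≤ A^∇`. The edges of optimal matchings for the two adjoint
entries and the edge `(j, k)`, with `(l, i)` added, form a `2`-regular bipartite multigraph, which
splits into a matching through `(l, i)` and another matching. -/
theorem adjoint_mul_mul_adjoint_le (A : Matrix (Fin n) (Fin n) Rmax) (i j k l : Fin n) :
    adjoint A i j * A j k * adjoint A k l ≤ A.permanent * adjoint A i l := by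
  obtain ⟨α, hα, eα⟩ := exists_adjoint_eq A i j
  obtain ⟨β, hβ, eβ⟩ := exists_adjoint_eq A k l
  have hcol1 : ∀ (π : Equiv.Perm (Fin n)) (a r : Fin n),
      ∑ c, (if c ≠ a ∧ π c = r then 1 else 0) = if r = π a then 0 else 1 := by
    intro π a r
    rw [Finset.sum_congr rfl fun c _ => if_congr
      (show c ≠ a ∧ π c = r ↔ c = π.symm r ∧ r ≠ π a by
        constructor
        · rintro ⟨h, rfl⟩; exact ⟨by simp, fun h' => h (π.injective h')⟩
        · rintro ⟨rfl, h⟩; exact ⟨fun h' => h (by rw [← h']; simp), by simp⟩) rfl rfl]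
    by_cases h : r = π a <;> simp [h]
  have hcol2 : ∀ a s r : Fin n,
      ∑ c, (if c = a ∧ s = r then 1 else 0) = if r = s then 1 else 0 := by
    intro a s r
    by_cases h : s = r
    · simp [h]
    · simp [h, Ne.symm h]
  obtain ⟨σ, τ, hN⟩ := exists_perm_add_eq (fun c r : Fin n =>
    (if c ≠ i ∧ α c = r then 1 else 0) + (if c = k ∧ j = r then 1 else 0)
      + (if c ≠ k ∧ β c = r then 1 else 0) + (if c = i ∧ l = r then 1 else 0))
    (by
      intro c
      simp only [Finset.sum_add_distrib, ite_and, Finset.sum_ite_irrel, Finset.sum_ite_eq,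
        Finset.mem_univ, if_true, Finset.sum_const_zero, ne_eq, ite_not]
      split_ifs <;> rfl)
    (by
      intro r
      simp only [Finset.sum_add_distrib, hcol1, hcol2, hα, hβ]
      split_ifs <;> rfl)
  -- one of the two matchings contains the added edge
  have hkey : ∀ σ τ : Equiv.Perm (Fin n), σ i = l → (∀ c r : Fin n,
      (if c ≠ i ∧ α c = r then 1 else 0) + (if c = k ∧ j = r then 1 else 0)
        + (if c ≠ k ∧ β c = r then 1 else 0) + (if c = i ∧ l = r then 1 else 0)
      = (if σ c = r then 1 else 0) + (if τ c = r then 1 else 0)) →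
      adjoint A i j * A j k * adjoint A k l ≤ A.permanent * adjoint A i l := by
    intro σ τ hσ hN
    have hN' : ∀ c r : Fin n, (if c ≠ i ∧ α c = r then 1 else 0)
        + (if c = k ∧ j = r then 1 else 0) + (if c ≠ k ∧ β c = r then 1 else 0)
        = (if c ≠ i ∧ σ c = r then 1 else 0) + (if True ∧ τ c = r then 1 else 0) := by
      intro c r
      have h := hN c r
      by_cases hc : c = i
      · subst hc
        rw [hσ] at h
        simp at h ⊢
        omega
      · simpa [hc] using h
    have hprod : ∀ (p : Fin n → Prop) [DecidablePred p] (f : Fin n → Fin n),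
        ∏ c, ∏ r, A r c ^ (if p c ∧ f c = r then 1 else 0) = ∏ c with p c, A (f c) c := by
      intro p _ f
      rw [Finset.prod_filter]
      refine Finset.prod_congr rfl fun c _ => ?_
      by_cases hp : p c
      · simp [hp, pow_ite]
      · simp [hp]
    have h : ∏ c, ∏ r, A r c ^ ((if c ≠ i ∧ α c = r then 1 else 0)
        + (if c = k ∧ j = r then 1 else 0) + (if c ≠ k ∧ β c = r then 1 else 0))
        = ∏ c, ∏ r, A r c ^ ((if c ≠ i ∧ σ c = r then 1 else 0)
          + (if True ∧ τ c = r then 1 else 0)) :=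
      Finset.prod_congr rfl fun c _ => Finset.prod_congr rfl fun r _ => by rw [hN']
    simp only [pow_add, Finset.prod_mul_distrib] at h
    rw [hprod (fun c => c ≠ i) α, hprod (fun c => c = k) fun _ => j, hprod (fun c => c ≠ k) β,
      hprod (fun c => c ≠ i) σ, hprod (fun _ => True) τ, Finset.filter_eq', Finset.filter_ne',
      Finset.filter_ne', if_pos (Finset.mem_univ k), Finset.prod_singleton,
      Finset.filter_true] at h
    rw [eα, eβ, h, mul_comm]
    exact mul_le_mul' (prod_le_permanent A τ) (hσ ▸ prod_erase_le_adjoint A σ i)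
  have hi := hN i l
  by_cases hσ : σ i = l
  · exact hkey σ τ hσ hN
  · by_cases hτ : τ i = l
    · exact hkey τ σ hτ fun c r => (hN c r).trans (add_comm _ _)
    · simp [hσ, hτ] at hi

section QuasiInverse

variable {A : Matrix (Fin n) (Fin n) Rmax}

theorem quasiInverse_apply (A : Matrix (Fin n) (Fin n) Rmax) (i j : Fin n) :
    quasiInverse A i j = A.permanent⁻¹ * adjoint A i j := rfl

theorem quasiInverse_mul_mul_quasiInverse_le (hA : A.permanent ≠ 0) (i j k l : Fin n) :
    quasiInverse A i j * A j k * quasiInverse A k l ≤ quasiInverse A i l := by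
  simp only [quasiInverse_apply]
  calc A.permanent⁻¹ * adjoint A i j * A j k * (A.permanent⁻¹ * adjoint A k l)
      = A.permanent⁻¹ * (A.permanent⁻¹ * (adjoint A i j * A j k * adjoint A k l)) := by ring
    _ ≤ A.permanent⁻¹ * (A.permanent⁻¹ * (A.permanent * adjoint A i l)) :=
        mul_le_mul' le_rfl (mul_le_mul' le_rfl (adjoint_mul_mul_adjoint_le A i j k l))
    _ = _ := by rw [inv_mul_cancel_left₀ hA]

theorem quasiInverse_mul_le_one (hA : A.permanent ≠ 0) (i j : Fin n) :
    quasiInverse A i j * A j i ≤ 1 := by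
  obtain ⟨σ, rfl, h⟩ := exists_adjoint_eq A i j
  rw [quasiInverse_apply, h, mul_assoc, Finset.prod_erase_mul _ _ (Finset.mem_univ i)]
  exact (mul_le_mul' le_rfl (prod_le_permanent A σ)).trans (inv_mul_cancel₀ hA).le

theorem ne_zero_of_permanent_eq (hA : A.permanent ≠ 0) {σ : Equiv.Perm (Fin n)}
    (hσ : A.permanent = ∏ i, A (σ i) i) (i : Fin n) : A (σ i) i ≠ 0 :=
  Finset.prod_ne_zero_iff.1 (fun h => hA (hσ.trans h)) i (Finset.mem_univ i)

/-- The quasi-inverse dominates the inverse of the monomial matrix supported by an optimal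
permutation. -/
theorem inv_le_quasiInverse (hA : A.permanent ≠ 0) {σ : Equiv.Perm (Fin n)}
    (hσ : A.permanent = ∏ i, A (σ i) i) (i : Fin n) :
    (A (σ i) i)⁻¹ ≤ quasiInverse A i (σ i) := by
  have h : A.permanent = A (σ i) i * ∏ k ∈ Finset.univ.erase i, A (σ k) k := by
    rw [hσ, Finset.mul_prod_erase _ (fun k => A (σ k) k) (Finset.mem_univ i)]
  have h0 : ∏ k ∈ Finset.univ.erase i, A (σ k) k ≠ 0 := right_ne_zero_of_mul (h ▸ hA)
  rw [quasiInverse_apply]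
  refine le_trans (le_of_eq ?_) (mul_le_mul' le_rfl (prod_erase_le_adjoint A σ i))
  rw [h, mul_inv, mul_assoc, inv_mul_cancel₀ h0, mul_one]

/-- Contraction of paths: the entries of `A` in the columns outside `I` join the entries of the
quasi-inverse to paths, and each path through `A^∇ A A^∇` is bounded by a single entry. -/
theorem exists_prod_mul_prod_quasiInverse_le (hA : A.permanent ≠ 0) (τ ρ : Equiv.Perm (Fin n))
    (J : Finset (Fin n)) :
    ∃ ρ' : Equiv.Perm (Fin n), (∀ c ∈ J, ρ' c = c) ∧
      (∏ c ∈ J, A (τ c) c) * ∏ c, quasiInverse A (ρ c) (τ c)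
        ≤ ∏ c ∈ Jᶜ, quasiInverse A (ρ' c) (τ c) := by
  classical
  induction J using Finset.induction_on with
  | empty => exact ⟨ρ, by simp, by simp⟩
  | insert a J ha ih =>
    obtain ⟨ρ', hfix, hle⟩ := ih
    have haJ : a ∈ Jᶜ := Finset.mem_compl.2 ha
    refine ⟨Equiv.swap a (ρ' a) * ρ', ?_, ?_⟩
    · intro c hc
      rcases Finset.mem_insert.1 hc with rfl | hc
      · simp
      · have hca : c ≠ a := fun h => ha (h ▸ hc)
        rw [Equiv.Perm.mul_apply, hfix c hc, Equiv.swap_apply_of_ne_of_ne hca]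
        exact fun h => hca (ρ'.injective ((hfix c hc).trans h))
    rw [Finset.prod_insert ha, mul_assoc]
    refine (mul_le_mul' le_rfl hle).trans ?_
    have hcompl : (insert a J)ᶜ = Jᶜ.erase a := by ext; simp
    rw [hcompl, ← Finset.mul_prod_erase Jᶜ _ haJ, ← mul_assoc, mul_comm (A (τ a) a)]
    by_cases hρa : ρ' a = a
    · rw [hρa, Equiv.swap_self]
      exact (mul_le_mul' (quasiInverse_mul_le_one hA a (τ a)) le_rfl).trans (one_mul _).le
    · -- `b` is the predecessor of `a`; the contracted path leads from `ρ' a` to `τ b`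
      obtain ⟨b, hb⟩ := ρ'.surjective a
      have hba : b ≠ a := fun h => hρa (h ▸ hb)
      have hbJ : b ∈ Jᶜ.erase a :=
        Finset.mem_erase.2 ⟨hba, Finset.mem_compl.2 fun h => hba ((hfix b h).symm.trans hb)⟩
      rw [← Finset.mul_prod_erase _ _ hbJ, ← Finset.mul_prod_erase _ _ hbJ, ← mul_assoc]
      refine mul_le_mul' ?_ (Finset.prod_le_prod' fun c hc => le_of_eq ?_)
      · rw [Equiv.Perm.mul_apply, hb, Equiv.swap_apply_left]
        exact quasiInverse_mul_mul_quasiInverse_le hA _ _ _ _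
      · have hcb : c ≠ b := (Finset.mem_erase.1 hc).1
        have hca : c ≠ a := (Finset.mem_erase.1 (Finset.mem_erase.1 hc).2).1
        rw [Equiv.Perm.mul_apply, Equiv.swap_apply_of_ne_of_ne]
        · exact fun h => hcb (ρ'.injective (h.trans hb.symm))
        · exact fun h => hca (ρ'.injective h)

theorem permanent_quasiInverse (hA : A.permanent ≠ 0) :
    (quasiInverse A).permanent = A.permanent⁻¹ := by
  obtain ⟨σ, hσ⟩ := exists_permanent_eq A
  refine le_antisymm ?_ ?_
  · obtain ⟨π, hπ⟩ := exists_permanent_eq (quasiInverse A)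
    obtain ⟨ρ, -, h⟩ := exists_prod_mul_prod_quasiInverse_le hA σ (π * σ) Finset.univ
    -- contracting along all columns leaves only closed paths, of weight at most `1`
    rw [← hσ, Finset.compl_univ, Finset.prod_empty] at h
    have hre : (quasiInverse A).permanent = ∏ c, quasiInverse A ((π * σ) c) (σ c) := by
      rw [hπ, ← Equiv.prod_comp σ]
      rfl
    rw [← hre] at h
    rwa [← one_div, le_div_iff₀ (zero_lt_iff.2 hA), mul_comm]
  · rw [hσ, ← Finset.prod_inv_distrib, ← Matrix.permanent_transpose]
    exact (Finset.prod_le_prod' fun i _ => inv_le_quasiInverse hA hσ i).trans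
      (prod_le_permanent (quasiInverse A).transpose σ)

end QuasiInverse

/-! ### Comparison of characteristic polynomials -/

theorem eval_charpoly_le_conj {A E : Matrix (Fin n) (Fin n) Rmax} (hE : E.permanent ≠ 0)
    (x : Rmax) : (charpoly A).eval x ≤ (charpoly (quasiInverse E * A * E)).eval x := by
  obtain ⟨σ, hσ⟩ := exists_permanent_eq E
  obtain ⟨τ, S, hS, h⟩ := exists_eval_charpoly_eq A x
  have h0 := ne_zero_of_permanent_eq hE hσ
  have hentry : ∀ i j, (E (σ i) i)⁻¹ * A (σ i) (σ j) * E (σ j) j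
      ≤ (quasiInverse E * A * E) i j := by
    intro i j
    rw [Matrix.mul_apply]
    refine le_trans ?_ (le_sum (fun k => (quasiInverse E * A) i k * E k j) (Finset.mem_univ (σ j)))
    refine mul_le_mul' ?_ le_rfl
    rw [Matrix.mul_apply]
    exact le_trans (mul_le_mul' (inv_le_quasiInverse hE hσ i) le_rfl)
      (le_sum (fun k => quasiInverse E i k * A k (σ j)) (Finset.mem_univ (σ i)))
  set T := S.map σ.symm.toEmbedding with hT
  have hmem : ∀ i, i ∈ T ↔ σ i ∈ S := by
    intro i
    simp [hT, Finset.mem_map_equiv]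
  set τ' : Equiv.Perm (Fin n) := σ⁻¹ * τ * σ with hτ'
  have hτσ : ∀ i, σ (τ' i) = τ (σ i) := fun i => by simp [hτ']
  have hfix : ∀ i ∈ T, τ' i = i := fun i hi =>
    σ.injective ((hτσ i).trans (hS _ ((hmem i).1 hi)))
  refine le_trans (le_of_eq ?_) (le_trans
    (mul_le_mul' (le_refl (∏ _i ∈ T, x)) (Finset.prod_le_prod' fun i (_ : i ∈ Tᶜ) =>
      hentry (τ' i) i)) (prod_le_eval_charpoly _ x τ' T hfix))
  -- on `Tᶜ`, which `τ'` permutes, the conjugating factors cancel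
  have hcancel : (∏ i ∈ Tᶜ, (E (σ (τ' i)) (τ' i))⁻¹) * ∏ i ∈ Tᶜ, E (σ i) i = 1 := by
    have hperm : ∏ i ∈ Tᶜ, (E (σ (τ' i)) (τ' i))⁻¹ = ∏ i ∈ Tᶜ, (E (σ i) i)⁻¹ :=
      Finset.prod_equiv τ' (fun i => by
        simp only [Finset.mem_compl, hmem]
        by_cases hi : σ i ∈ S
        · rw [hτσ, hS _ hi]
        · simp only [hi, not_false_eq_true, true_iff]
          intro h'
          rw [hτσ] at h'
          exact hi (by rwa [τ.injective (hS _ h')] at h')) fun i _ => rfl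
    rw [hperm, ← Finset.prod_mul_distrib]
    exact Finset.prod_eq_one fun i _ => inv_mul_cancel₀ (h0 i)
  have hmain : ∏ i ∈ Tᶜ, A (σ (τ' i)) (σ i) = ∏ i ∈ Sᶜ, A (τ i) i :=
    Finset.prod_equiv σ (fun i => by simp [hmem]) fun i _ => by rw [hτσ]
  rw [h, Finset.prod_mul_distrib, Finset.prod_mul_distrib, hmain,
    mul_right_comm (∏ i ∈ Tᶜ, (E (σ (τ' i)) (τ' i))⁻¹), hcancel, one_mul]
  simp [hT]

/-- A path of length `m` contributes its weight to an entry of `A ^ m`. -/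
theorem prod_apply_le_pow_apply (A : Matrix (Fin n) (Fin n) Rmax) (τ : Equiv.Perm (Fin n)) (m : ℕ)
    (i : Fin n) : ∏ t ∈ Finset.range m, A (τ ((τ ^ t) i)) ((τ ^ t) i) ≤ (A ^ m) ((τ ^ m) i) i := by
  induction m with
  | zero => simp
  | succ m ih =>
    rw [Finset.prod_range_succ, mul_comm, pow_succ' A, Matrix.mul_apply, pow_succ' τ,
      Equiv.Perm.mul_apply]
    exact (mul_le_mul' le_rfl ih).trans
      (le_sum (fun k => A (τ ((τ ^ m) i)) k * (A ^ m) k i) (Finset.mem_univ ((τ ^ m) i)))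

theorem eval_charpoly_pow_le (A : Matrix (Fin n) (Fin n) Rmax) (m : ℕ) (x : Rmax) :
    (charpoly A).eval x ^ m ≤ (charpoly (A ^ m)).eval (x ^ m) := by
  obtain ⟨τ, S, hS, h⟩ := exists_eval_charpoly_eq A x
  have hinv : ∀ t : ℕ, ∀ i ∈ S, (τ ^ t) i = i := fun t i hi =>
    Function.IsFixedPt.perm_pow (hS i hi) t
  refine le_trans (le_of_eq ?_) (le_trans
    (mul_le_mul' (le_refl (∏ _i ∈ S, x ^ m)) (Finset.prod_le_prod' fun i (_ : i ∈ Sᶜ) =>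
      prod_apply_le_pow_apply A τ m i)) (prod_le_eval_charpoly _ (x ^ m) (τ ^ m) S (hinv m)))
  rw [Finset.prod_comm, h, mul_pow, ← Finset.prod_pow]
  congr 1
  rw [← Finset.card_range m, ← Finset.prod_const, Finset.card_range]
  refine Finset.prod_congr rfl fun t _ => ?_
  symm
  refine Finset.prod_equiv (τ ^ t) (fun i => ?_) fun i _ => rfl
  -- `τ ^ t` permutes `Sᶜ`, as it fixes `S` pointwise
  simp only [Finset.mem_compl, not_iff_not]
  refine ⟨fun hi => by rwa [hinv t i hi], fun hi => ?_⟩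
  rwa [(τ ^ t).injective (hinv t _ hi)] at hi

/-- A max-plus version of Jacobi's identity for the minors of an inverse matrix, summed over all
principal minors. -/
theorem le_eval_charpoly_quasiInverse {A : Matrix (Fin n) (Fin n) Rmax} (hA : A.permanent ≠ 0)
    {x : Rmax} (hx : x ≠ 0) :
    A.permanent⁻¹ * (x ^ n * (charpoly A).eval x⁻¹) ≤ (charpoly (quasiInverse A)).eval x := by
  obtain ⟨σ, hσ⟩ := exists_permanent_eq A
  obtain ⟨τ, S, hS, h⟩ := exists_eval_charpoly_eq A x⁻¹
  obtain ⟨ρ, hρ, hle⟩ := exists_prod_mul_prod_quasiInverse_le hA τ (σ⁻¹ * τ) Sᶜ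
  rw [compl_compl] at hle
  have hdet : A.permanent⁻¹ ≤ ∏ c, quasiInverse A ((σ⁻¹ * τ) c) (τ c) := by
    rw [hσ, ← Finset.prod_inv_distrib, ← Equiv.prod_comp (σ⁻¹ * τ)]
    refine Finset.prod_le_prod' fun c _ => ?_
    simpa using inv_le_quasiInverse hA hσ ((σ⁻¹ * τ) c)
  have hxn : x ^ n * ∏ _i ∈ S, x⁻¹ = ∏ _i ∈ Sᶜ, x := by
    rw [show x ^ n = ∏ _i : Fin n, x by simp, ← Finset.prod_mul_prod_compl S, mul_right_comm,
      ← Finset.prod_mul_distrib]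
    simp [hx]
  rw [h]
  calc A.permanent⁻¹ * (x ^ n * ((∏ _i ∈ S, x⁻¹) * ∏ i ∈ Sᶜ, A (τ i) i))
      = (x ^ n * ∏ _i ∈ S, x⁻¹) * ((∏ i ∈ Sᶜ, A (τ i) i) * A.permanent⁻¹) := by ring
    _ ≤ (∏ _i ∈ Sᶜ, x) * ∏ c ∈ S, quasiInverse A (ρ c) (τ c) :=
        mul_le_mul' hxn.le ((mul_le_mul' le_rfl hdet).trans hle)
    _ = (∏ _i ∈ Sᶜ, x) * ∏ c ∈ Sᶜᶜ, quasiInverse A (ρ c) c := by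
        rw [compl_compl]
        congr 1
        exact Finset.prod_congr rfl fun c hc => by rw [hS c hc]
    _ ≤ _ := prod_le_eval_charpoly _ x ρ Sᶜ hρ

theorem Nonsingular.permanent_ne_zero {A : Matrix (Fin n) (Fin n) Rmax} (hA : Nonsingular A) :
    A.permanent ≠ 0 :=
  IsUnit.ne_zero hA

/-! ### Ordered lists of eigenvalues -/

theorem exists_listsEigenvalues_antitone (A : Matrix (Fin n) (Fin n) Rmax) (g : Rmax → Rmax) :
    ∃ γ : Fin n → Rmax, ListsEigenvalues A γ ∧ Antitone fun i => g (γ i) := by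
  obtain ⟨γ, hγ⟩ := exists_eval_charpoly_eq_prod_max A
  set σ := Tuple.sort fun i => OrderDual.toDual (g (γ i)) with hσ
  refine ⟨γ ∘ σ, listsEigenvalues_of_eval_eq_prod_max fun x => ?_, ?_⟩
  · rw [hγ]
    exact (Equiv.prod_comp σ fun i => max x (γ i)).symm
  · exact fun i j hij => Tuple.monotone_sort (fun i => OrderDual.toDual (g (γ i))) hij

theorem ListsEigenvalues.prod_eq {A : Matrix (Fin n) (Fin n) Rmax} {γ : Fin n → Rmax}
    (hγ : ListsEigenvalues A γ) : ∏ i, γ i = A.permanent := by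
  rw [← eval_charpoly_zero, hγ.eval_charpoly]
  exact Finset.prod_congr rfl fun i _ => (max_eq_right zero_le).symm

variable {A M : Matrix (Fin n) (Fin n) Rmax} {g : Rmax → Rmax} {γ : Fin n → Rmax}

theorem ListsEigenvalues.ne_zero (hγ : ListsEigenvalues A γ) (hA : A.permanent ≠ 0) (i : Fin n) :
    γ i ≠ 0 :=
  Finset.prod_ne_zero_iff.1 (fun h => hA (hγ.prod_eq.symm.trans h)) i (Finset.mem_univ i)

/-- In each of the three cases, the polynomial function with roots `g (γ i)` is dominated by the
characteristic polynomial function of `M`. -/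
theorem ListsEigenvalues.prod_max_le_eval_charpoly (hγ : ListsEigenvalues A γ)
    (hcase : ConjugationCase A M g ∨ QuasiInverseCase A M g ∨ PowerCase A M g)
    {x : Rmax} (hx : x ≠ 0) : ∏ i, max x (g (γ i)) ≤ (charpoly M).eval x := by
  rcases hcase with ⟨E, hE, rfl, rfl⟩ | ⟨hA, rfl, rfl⟩ | ⟨m, hm, rfl, rfl⟩
  · rw [← hγ.eval_charpoly]
    exact eval_charpoly_le_conj hE.permanent_ne_zero x
  · have hdet := hA.permanent_ne_zero
    refine le_trans (le_of_eq ?_) (le_eval_charpoly_quasiInverse hdet hx)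
    have hxn : x ^ n = ∏ _i : Fin n, x := by simp
    rw [hγ.eval_charpoly, hxn, ← hγ.prod_eq, ← Finset.prod_inv_distrib, ← Finset.prod_mul_distrib,
      ← Finset.prod_mul_distrib]
    refine Finset.prod_congr rfl fun i _ => ?_
    have h0 := hγ.ne_zero hdet i
    have h : (γ i)⁻¹ * (x * (x⁻¹ + γ i)) = (γ i)⁻¹ + x := by
      rw [mul_add, mul_inv_cancel₀ hx, mul_add, mul_one, mul_left_comm, inv_mul_cancel₀ h0, mul_one]
    exact (max_comm _ _).trans h.symm
  · have hm0 : m ≠ 0 := Nat.one_le_iff_ne_zero.1 hm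
    obtain ⟨y, rfl⟩ := exists_pow_eq x hm0
    refine le_trans (le_of_eq ?_) (eval_charpoly_pow_le A m y)
    rw [hγ.eval_charpoly, ← Finset.prod_pow]
    exact Finset.prod_congr rfl fun i _ =>
      ((pow_left_mono m).map_max (a := y) (b := γ i)).symm

end Rmax

theorem corollary6p8 {n : ℕ} (A M : Matrix (Fin n) (Fin n) Rmax) (g : Rmax → Rmax)
    (hcase : Rmax.ConjugationCase A M g ∨ Rmax.QuasiInverseCase A M g ∨ Rmax.PowerCase A M g) :
    -- `M` and `A` have `n` eigenvalues counted with multiplicities, and these can be ordered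
    (∃ lam gam : Fin n → Rmax,
      Rmax.ListsEigenvalues M lam ∧ Rmax.ListsEigenvalues A gam ∧
      Antitone lam ∧ Antitone (fun i => g (gam i))) ∧
    -- the inequalities hold for all such ordered lists
    (∀ lam gam : Fin n → Rmax,
      Rmax.ListsEigenvalues M lam → Rmax.ListsEigenvalues A gam →
      Antitone lam → Antitone (fun i => g (gam i)) →
      (∀ k : Fin n, ∏ i ∈ Finset.Iic k, lam i ≥ ∏ i ∈ Finset.Iic k, g (gam i)) ∧
      (Rmax.QuasiInverseCase A M g →
        (∀ i, gam i ≠ 0) ∧ ∏ i, lam i = ∏ i, g (gam i))) := by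
  refine ⟨?_, fun lam gam hlam hgam hlam_anti _ => ⟨fun k => ?_, ?_⟩⟩
  · obtain ⟨lam, hlam, hlam_anti⟩ := Rmax.exists_listsEigenvalues_antitone M id
    obtain ⟨gam, hgam, hgam_anti⟩ := Rmax.exists_listsEigenvalues_antitone A g
    exact ⟨lam, gam, hlam, hgam, hlam_anti, hgam_anti⟩
  · refine Rmax.prod_Iic_le_of_prod_max_le hlam_anti (fun x hx => ?_) k
    rw [← hlam.eval_charpoly]
    exact hgam.prod_max_le_eval_charpoly hcase hx
  · rintro ⟨hA, rfl, rfl⟩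
    have hdet := hA.permanent_ne_zero
    refine ⟨hgam.ne_zero hdet, ?_⟩
    rw [hlam.prod_eq, Rmax.permanent_quasiInverse hdet, Finset.prod_inv_distrib, hgam.prod_eq]
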